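/- **Conventions.** $\mathbb R^m$, $\mathbb R^n$ and $\mathbb R^m\times\mathbb R^n$ carry the Euclidean inner products, and $\mathcal{C}^\circ:=\{z^*\mid \langle z^*,z\rangle\le 0\ \forall z\in \mathcal{C}\}$. A set $\Omega$ is locally closed around a point $z$ (which need not belong to $\Omega$) if $\Omega\cap U$ is closed for some closed neighbourhood $U$ of $z$. For a set $\Omega$ and $z\in\Omega$ let $$T_\Omega(z):=\{w\mid \exists\, t_k\downarrow 0,\ w_k\to w:\ z+t_kw_k\in\Omega\ \forall k\},\qquad \widehat N_\Omega(z):=T_\Omega(z)^\circ,$$ $$N_\Omega(z):=\{z^*\mid\exists\, z_k\to z,\ z_k^*\to z^*:\ z_k^*\in\widehat N_\Omega(z_k)\ \forall k\},$$ $$N_\Omega(z;w):=\{z^*\mid\exists\, t_k\downarrow 0,\ w_k\to w,\ z_k^*\to z^*:\ z_k^*\in\widehat N_\Omega(z+t_kw_k)\ \forall k\},$$ and let all these sets be empty if $z\notin\Omega$. Here $t_k\downarrow0$ means $t_k>0$ and $t_k\to0$. For $M:\mathbb R^m\rightrightarrows\mathbb R^n$ let $\operatorname{dom}M:=\{y\mid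 M(y)\ne\varnothing\}$, $\operatorname{gph}M:=\{(y,x)\mid x\in M(y)\}$ and, for $(\bar y,\bar x)\in\operatorname{gph}M$, $$DM(\bar y,\bar x)(v):=\{u\mid (v,u)\in T_{\operatorname{gph}M}(\bar y,\bar x)\},\qquad \widehat D^*M(\bar y,\bar x)(x^*):=\{y^*\mid (y^*,-x^*)\in\widehat N_{\operatorname{gph}M}(\bar y,\bar x)\},$$ $$D^*M(\bar y,\bar x)(x^*):=\{y^*\mid (y^*,-x^*)\in N_{\operatorname{gph}M}(\bar y,\bar x)\},$$ $$D^*M((\bar y,\bar x);(v,u))(x^*):=\{y^*\mid (y^*,-x^*)\in N_{\operatorname{gph}M}((\bar y,\bar x);(v,u))\}.$$ The domains of these set-valued mappings are defined as for $M$. The mapping $M$ is inner semicompact at $\bar y$ w.r.t. $\Omega$ if for each sequence $(y_k)\subset\Omega$ with $y_k\to\bar y$ there are $\bar x\in\mathbb R^n$ and $x_k\to\bar x$ such that $x_k\in M(y_k)$ along a subsequence. FOSCclm holds at $(\bar y,\bar x)$ if $$D^*M((\bar y,\bar x);(0,u))(0)=\{0\}\qquad\forall u\in DM(\bar y,\bar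 x)(0)\setminus\{0\}.$$ **Theorem.** Let $M:\mathbb R^m\rightrightarrows\mathbb R^n$ be a set-valued mapping and fix $\bar y\in\operatorname{dom}M$. (i) Assume that $\operatorname{gph}M$ is locally closed around every point of $\{\bar y\}\times\mathbb R^n$, that $M$ is inner semicompact at $\bar y$ w.r.t. $\operatorname{dom}M$, and that FOSCclm holds at $(\bar y,\bar x)$ for each $\bar x\in M(\bar y)$. Then, for every $v\in\mathbb R^m$, $$T_{\operatorname{dom}M}(\bar y)=\bigcup_{\bar x\in M(\bar y)}\operatorname{dom}DM(\bar y,\bar x),\qquad \widehat N_{\operatorname{dom}M}(\bar y)=\bigcap_{\bar x\in M(\bar y)}\widehat D^*M(\bar y,\bar x)(0),$$ $$N_{\operatorname{dom}M}(\bar y)\subset\bigcup_{\bar x\in M(\bar y)}D^*M(\bar y,\bar x)(0),\qquad N_{\operatorname{dom}M}(\bar y;v)\subset\bigcup_{\bar x\in M(\bar y)}\ \bigcup_{u\in DM(\bar y,\bar x)(v)}D^*M((\bar y,\bar x);(v,u))(0).$$ (ii) Let $\bar x\in M(\bar y)$, let $\operatorname{gph}M$ be locally closed around $(\bar y,\bar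 x)$, and assume that FOSCclm holds at $(\bar y,\bar x)$. Then, for every $u\in\mathbb R^n$, $$T_{M(\bar y)}(\bar x)=DM(\bar y,\bar x)(0),\qquad \widehat N_{M(\bar y)}(\bar x)\supset-\operatorname{dom}\widehat D^*M(\bar y,\bar x),$$ $$N_{M(\bar y)}(\bar x)\subset-\operatorname{dom}D^*M(\bar y,\bar x),\qquad N_{M(\bar y)}(\bar x;u)\subset-\operatorname{dom}D^*M((\bar y,\bar x);(0,u)).$$ -/

import Mathlib

open Filter Topology
open scoped Pointwise

namespace VarAn

section Cones

variable {E : Type*} [NormedAddCommGroup E] [InnerProductSpace ℝ E]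

/-- `Ω` is locally closed around `z`: its trace on some closed neighbourhood of `z` is closed.
The point `z` itself need not belong to `Ω`. -/
def LocallyClosedAround (Ω : Set E) (z : E) : Prop :=
  ∃ U ∈ 𝓝 z, IsClosed U ∧ IsClosed (Ω ∩ U)

/-- The polar cone of `Ω`. -/
def polarCone (Ω : Set E) : Set E :=
  {zs | ∀ z ∈ Ω, inner ℝ zs z ≤ 0}

/-- The tangent (Bouligand, contingent) cone to `Ω` at `z`; empty if `z ∉ Ω`. -/
def tangentCone (Ω : Set E) (z : E) : Set E :=
  {w | z ∈ Ω ∧ ∃ (t : ℕ → ℝ) (w' : ℕ → E),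
    (∀ k, 0 < t k) ∧ Tendsto t atTop (𝓝 0) ∧ Tendsto w' atTop (𝓝 w) ∧
      ∀ k, z + t k • w' k ∈ Ω}

/-- The regular (Fréchet) normal cone to `Ω` at `z`; empty if `z ∉ Ω`. -/
def regularNormalCone (Ω : Set E) (z : E) : Set E :=
  {zs | z ∈ Ω ∧ zs ∈ polarCone (tangentCone Ω z)}

/-- The limiting (Mordukhovich) normal cone to `Ω` at `z`; empty if `z ∉ Ω`. -/
def limitingNormalCone (Ω : Set E) (z : E) : Set E :=
  {zs | z ∈ Ω ∧ ∃ (z' zs' : ℕ → E),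
    Tendsto z' atTop (𝓝 z) ∧ Tendsto zs' atTop (𝓝 zs) ∧
      ∀ k, zs' k ∈ regularNormalCone Ω (z' k)}

/-- The directional limiting normal cone to `Ω` at `z` in direction `w`; empty if `z ∉ Ω`. -/
def dirLimitingNormalCone (Ω : Set E) (z w : E) : Set E :=
  {zs | z ∈ Ω ∧ ∃ (t : ℕ → ℝ) (w' zs' : ℕ → E),
    (∀ k, 0 < t k) ∧ Tendsto t atTop (𝓝 0) ∧ Tendsto w' atTop (𝓝 w) ∧
      Tendsto zs' atTop (𝓝 zs) ∧ ∀ k, zs' k ∈ regularNormalCone Ω (z + t k • w' k)}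

end Cones

section SetValued

/-- The domain of a set-valued mapping. -/
def svDom {Y X : Type*} (M : Y → Set X) : Set Y :=
  {y | (M y).Nonempty}

variable {Y X : Type*} [NormedAddCommGroup Y] [InnerProductSpace ℝ Y]
  [NormedAddCommGroup X] [InnerProductSpace ℝ X]

/-- The element `(y, x)` of the product space `Y × X`, which carries the sum inner product. -/
abbrev pair (y : Y) (x : X) : WithLp 2 (Y × X) := WithLp.toLp 2 (y, x)

/-- The graph of a set-valued mapping. -/
def svGraph (M : Y → Set X) : Set (WithLp 2 (Y × X)) :=
  {p | p.snd ∈ M p.fst}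

/-- The graphical (Bouligand) derivative `DM(y, x)`. -/
def graphicalDeriv (M : Y → Set X) (y : Y) (x : X) (v : Y) : Set X :=
  {u | pair v u ∈ tangentCone (svGraph M) (pair y x)}

/-- The regular (Fréchet) coderivative of `M` at `(y, x)`. -/
def regularCoderiv (M : Y → Set X) (y : Y) (x : X) (xs : X) : Set Y :=
  {ys | pair ys (-xs) ∈ regularNormalCone (svGraph M) (pair y x)}

/-- The limiting (Mordukhovich) coderivative of `M` at `(y, x)`. -/
def limitingCoderiv (M : Y → Set X) (y : Y) (x : X) (xs : X) : Set Y :=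
  {ys | pair ys (-xs) ∈ limitingNormalCone (svGraph M) (pair y x)}

/-- The directional limiting coderivative of `M` at `(y, x)` in direction `(v, u)`. -/
def dirLimitingCoderiv (M : Y → Set X) (y : Y) (x : X) (v : Y) (u : X) (xs : X) : Set Y :=
  {ys | pair ys (-xs) ∈ dirLimitingNormalCone (svGraph M) (pair y x) (pair v u)}

/-- `M` is inner semicompact at `y` w.r.t. `Ω`: for each sequence in `Ω` converging to `y`, along
a subsequence there are points in the images of `M` which converge. -/
def InnerSemicompactAt (M : Y → Set X) (y : Y) (Ω : Set Y) : Prop :=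
  ∀ y' : ℕ → Y, (∀ k, y' k ∈ Ω) → Tendsto y' atTop (𝓝 y) →
    ∃ (x : X) (φ : ℕ → ℕ) (x' : ℕ → X),
      StrictMono φ ∧ Tendsto x' atTop (𝓝 x) ∧ ∀ k, x' k ∈ M (y' (φ k))

/-- The first-order sufficient condition for calmness at `(y, x)`. -/
def FOSCclm (M : Y → Set X) (y : Y) (x : X) : Prop :=
  ∀ u ∈ graphicalDeriv M y x 0 \ {0}, dirLimitingCoderiv M y x 0 u 0 = {0}

end SetValued

end VarAn

/-! `FOSCclm` excludes nonzero limits (y*, 0) of regular normals to the graph along directions (0,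
u) with u ≠ 0. By compactness this becomes a uniform bound ‖y*‖ ≤ κ‖x*‖ for regular normals (y*, x*)
at graph points (y, x) near (ybar, xbar) in the cone x ≠ xbar, ‖y - ybar‖ ≤ ε‖x - xbar‖
(`FOSCclm.exists_norm_fst_le`). A variational argument turns the bound into a Lipschitz-like
property of M in this cone (`FOSCclm.exists_lipschitzLike`).

For images, this yields calmness (`FOSCclm.exists_calm`), since outside the cone xbar itself is a
good enough approximation of x. Calmness transfers tangents directly; for normals, a quadratic
penalization of the constraint y = ybar approximates a normal to M(ybar) by graph normals, and
calmness keeps their first components bounded (`exists_regularNormalCone_svGraph_near`).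

For the domain, take y_k → ybar in dom M and preimages x_k → xbar. If the difference quotients of
x_k have a bounded subsequence, a direction u is found. Otherwise (y_k, x_k) enters the cone, and
the Lipschitz-like property gives a point of M(ybar) at which M is inner calm
(`exists_subseq_or_innerCalmAt`). Then ybar is interior to dom M, every v lies in the domain of the
graphical derivative there, and only the zero normal remains. -/

namespace VarAn

/-! ### Local closedness, tangent cones and normal cones -/

section ConeLemmas

variable {E : Type*} [NormedAddCommGroup E] {Ω : Set E} {z w : E}

/-- Limits of sequences in a set around whose limit the set is locally closed stay in the set. -/
theorem LocallyClosedAround.mem_of_tendsto (h : LocallyClosedAround Ω z) {z' : ℕ → E}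
    (hz' : Tendsto z' atTop (𝓝 z)) (hmem : ∀ k, z' k ∈ Ω) : z ∈ Ω := by
  obtain ⟨U, hU, -, hc⟩ := h
  refine (hc.mem_of_tendsto hz' ?_).1
  filter_upwards [hz' hU] with k hk using ⟨hmem k, hk⟩

/-- The centre is free because the minimization arguments below use balls around moving graph
points. -/
theorem LocallyClosedAround.exists_forall_closedBall (h : LocallyClosedAround Ω z) :
    ∃ ρ > 0, ∀ z₀ r, ‖z₀ - z‖ + r ≤ ρ → IsClosed (Ω ∩ Metric.closedBall z₀ r) := by
  obtain ⟨U, hU, -, hc⟩ := h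
  obtain ⟨ρ, hρ, hb⟩ := Metric.nhds_basis_closedBall.mem_iff.1 hU
  refine ⟨ρ, hρ, fun z₀ r hr => ?_⟩
  have hsub : Metric.closedBall z₀ r ⊆ U := fun x hx => hb (by
    rw [mem_closedBall_iff_norm] at hx ⊢
    calc ‖x - z‖ = ‖(x - z₀) + (z₀ - z)‖ := by congr 1; abel
      _ ≤ _ := (norm_add_le _ _).trans (by linarith))
  have : Ω ∩ Metric.closedBall z₀ r = (Ω ∩ U) ∩ Metric.closedBall z₀ r := by
    rw [Set.inter_assoc, Set.inter_eq_right.2 hsub]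
  rw [this]
  exact hc.inter Metric.isClosed_closedBall

variable [InnerProductSpace ℝ E]

theorem mem_tangentCone_of_eventually (hz : z ∈ Ω) {t : ℕ → ℝ} {w' : ℕ → E}
    (ht : ∀ᶠ k in atTop, 0 < t k) (ht0 : Tendsto t atTop (𝓝 0)) (hw : Tendsto w' atTop (𝓝 w))
    (hmem : ∀ᶠ k in atTop, z + t k • w' k ∈ Ω) : w ∈ tangentCone Ω z := by
  obtain ⟨N, hN⟩ := eventually_atTop.1 (ht.and hmem)
  exact ⟨hz, fun k => t (k + N), fun k => w' (k + N), fun k => (hN _ (by omega)).1,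
    (tendsto_add_atTop_iff_nat N).2 ht0, (tendsto_add_atTop_iff_nat N).2 hw,
    fun k => (hN _ (by omega)).2⟩

theorem mem_tangentCone_of_tendsto_smul_sub (hz : z ∈ Ω) {t : ℕ → ℝ} {z' : ℕ → E}
    (ht : ∀ᶠ k in atTop, 0 < t k) (ht0 : Tendsto t atTop (𝓝 0))
    (hw : Tendsto (fun k => (t k)⁻¹ • (z' k - z)) atTop (𝓝 w))
    (hmem : ∀ᶠ k in atTop, z' k ∈ Ω) : w ∈ tangentCone Ω z := by
  refine mem_tangentCone_of_eventually hz ht ht0 hw ?_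
  filter_upwards [ht, hmem] with k hk hk'
  simpa [smul_inv_smul₀ hk.ne'] using hk'

theorem tendsto_one_div_nat_succ :
    Tendsto (fun k : ℕ => (1 : ℝ) / ((k : ℝ) + 1)) atTop (𝓝 0) :=
  tendsto_one_div_add_atTop_nhds_zero_nat

theorem zero_mem_regularNormalCone (hz : z ∈ Ω) : (0 : E) ∈ regularNormalCone Ω z :=
  ⟨hz, fun w _ => by simp⟩

theorem smul_mem_regularNormalCone {p : E} (hp : p ∈ regularNormalCone Ω z) {c : ℝ}
    (hc : 0 ≤ c) : c • p ∈ regularNormalCone Ω z :=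
  ⟨hp.1, fun w hw => by
    rw [real_inner_smul_left]; exact mul_nonpos_of_nonneg_of_nonpos hc (hp.2 w hw)⟩

theorem zero_mem_dirLimitingNormalCone (hw : w ∈ tangentCone Ω z) :
    (0 : E) ∈ dirLimitingNormalCone Ω z w := by
  obtain ⟨hz, t, w', ht, ht0, hw', hmem⟩ := hw
  exact ⟨hz, t, w', fun _ => 0, ht, ht0, hw', tendsto_const_nhds,
    fun k => zero_mem_regularNormalCone (hmem k)⟩

theorem mem_dirLimitingNormalCone_of_tendsto_smul_sub (hz : z ∈ Ω) {p : E} {t : ℕ → ℝ}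
    {z' p' : ℕ → E} (ht : ∀ k, 0 < t k) (ht0 : Tendsto t atTop (𝓝 0))
    (hw : Tendsto (fun k => (t k)⁻¹ • (z' k - z)) atTop (𝓝 w))
    (hp : Tendsto p' atTop (𝓝 p)) (hmem : ∀ k, p' k ∈ regularNormalCone Ω (z' k)) :
    p ∈ dirLimitingNormalCone Ω z w := by
  refine ⟨hz, t, _, p', ht, ht0, hw, hp, fun k => ?_⟩
  simpa [smul_inv_smul₀ (ht k).ne'] using hmem k

theorem eq_zero_of_mem_regularNormalCone_of_mem_nhds (h : Ω ∈ 𝓝 z) {p : E}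
    (hp : p ∈ regularNormalCone Ω z) : p = 0 := by
  have hT : p ∈ tangentCone Ω z := by
    refine mem_tangentCone_of_eventually hp.1 (t := fun k => 1 / ((k : ℝ) + 1)) (w' := fun _ => p)
      (Eventually.of_forall fun k => by positivity) tendsto_one_div_nat_succ
      tendsto_const_nhds ?_
    have : Tendsto (fun k : ℕ => z + (1 / ((k : ℝ) + 1)) • p) atTop (𝓝 z) := by
      simpa using tendsto_const_nhds.add (tendsto_one_div_nat_succ.smul_const p)
    exact this h
  have := hp.2 p hT
  rwa [real_inner_self_nonpos] at this

end ConeLemmas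

/-! ### Product spaces and normals from local minima -/

section Product

variable {Y X : Type*} [NormedAddCommGroup Y] [NormedAddCommGroup X]

theorem tendsto_pair {ι : Type*} {l : Filter ι} {a : ι → Y} {b : ι → X} {y : Y} {x : X}
    (ha : Tendsto a l (𝓝 y)) (hb : Tendsto b l (𝓝 x)) :
    Tendsto (fun k => pair (a k) (b k)) l (𝓝 (pair y x)) :=
  ((WithLp.prod_continuous_toLp 2 Y X).tendsto (y, x)).comp (ha.prodMk_nhds hb)

theorem tendsto_fst {ι : Type*} {l : Filter ι} {a : ι → WithLp 2 (Y × X)} {z : WithLp 2 (Y × X)}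
    (ha : Tendsto a l (𝓝 z)) : Tendsto (fun k => (a k).fst) l (𝓝 z.fst) :=
  (WithLp.continuous_fst 2 Y X).continuousAt.tendsto.comp ha

theorem tendsto_snd {ι : Type*} {l : Filter ι} {a : ι → WithLp 2 (Y × X)} {z : WithLp 2 (Y × X)}
    (ha : Tendsto a l (𝓝 z)) : Tendsto (fun k => (a k).snd) l (𝓝 z.snd) :=
  (WithLp.continuous_snd 2 Y X).continuousAt.tendsto.comp ha

theorem norm_le_norm_fst_add_norm_snd (z : WithLp 2 (Y × X)) : ‖z‖ ≤ ‖z.fst‖ + ‖z.snd‖ := by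
  refine abs_le_of_sq_le_sq' ?_ (by positivity) |>.2
  rw [WithLp.prod_norm_sq_eq_of_L2]
  nlinarith [norm_nonneg z.fst, norm_nonneg z.snd]

variable [InnerProductSpace ℝ Y] [InnerProductSpace ℝ X]

theorem inner_pair (z : WithLp 2 (Y × X)) (a : Y) (b : X) :
    inner ℝ (pair a b) z = inner ℝ a z.fst + inner ℝ b z.snd :=
  WithLp.prod_inner_apply _ _

/-- Optimality condition for a separable quadratic function on a subset of a product space. -/
theorem mem_regularNormalCone_of_isLocalMin {G : Set (WithLp 2 (Y × X))} {z : WithLp 2 (Y × X)}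
    (hz : z ∈ G) {a b : ℝ} {p : Y} {q : X}
    (hmin : ∀ᶠ w in 𝓝 z, w ∈ G →
      a * ‖z.fst - p‖ ^ 2 + b * ‖z.snd - q‖ ^ 2 ≤ a * ‖w.fst - p‖ ^ 2 + b * ‖w.snd - q‖ ^ 2) :
    pair (a • (p - z.fst)) (b • (q - z.snd)) ∈ regularNormalCone G z := by
  refine ⟨hz, ?_⟩
  rintro w ⟨-, t, w', ht, ht0, hw, hmem⟩
  have hlim : Tendsto (fun k => z + t k • w' k) atTop (𝓝 z) := by
    simpa using tendsto_const_nhds.add (ht0.smul hw)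
  -- Expanding the squares at z + t w' and dividing by 2t leaves the linear term, bounded by a
  -- remainder of order t.
  have key : ∀ᶠ k in atTop, inner ℝ (pair (a • (p - z.fst)) (b • (q - z.snd))) (w' k) ≤
      t k / 2 * (a * ‖(w' k).fst‖ ^ 2 + b * ‖(w' k).snd‖ ^ 2) := by
    filter_upwards [hlim.eventually hmin] with k hk
    have h1 := hk (hmem k)
    have e1 : (z + t k • w' k).fst - p = t k • (w' k).fst - (p - z.fst) := by
      simp; abel
    have e2 : (z + t k • w' k).snd - q = t k • (w' k).snd - (q - z.snd) := by
      simp; abel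
    rw [norm_sub_rev z.fst, norm_sub_rev z.snd, e1, e2, norm_sub_sq_real (t k • _),
      norm_sub_sq_real (t k • _), norm_smul, norm_smul, real_inner_smul_left, real_inner_smul_left, mul_pow, mul_pow,
      Real.norm_eq_abs, sq_abs] at h1
    rw [inner_pair, real_inner_smul_left, real_inner_smul_left, real_inner_comm,
      real_inner_comm _ (q - z.snd)]
    have := ht k
    refine le_of_mul_le_mul_left ?_ this
    nlinarith
  have lhs : Tendsto (fun k => inner ℝ (pair (a • (p - z.fst)) (b • (q - z.snd))) (w' k)) atTop
      (𝓝 (inner ℝ (pair (a • (p - z.fst)) (b • (q - z.snd))) w)) :=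
    tendsto_const_nhds.inner hw
  have rhs : Tendsto (fun k => t k / 2 * (a * ‖(w' k).fst‖ ^ 2 + b * ‖(w' k).snd‖ ^ 2)) atTop
      (𝓝 (0 / 2 * (a * ‖w.fst‖ ^ 2 + b * ‖w.snd‖ ^ 2))) :=
    (ht0.div_const 2).mul ((((tendsto_fst hw).norm.pow 2).const_mul a).add
      (((tendsto_snd hw).norm.pow 2).const_mul b))
  have := le_of_tendsto_of_tendsto lhs rhs key
  simpa using this

variable {M : Y → Set X} {ybar : Y} {xbar : X}

theorem tangentCone_image_subset :
    tangentCone (M ybar) xbar ⊆ graphicalDeriv M ybar xbar 0 := by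
  rintro u ⟨hx, t, w, ht, ht0, hw, hmem⟩
  refine ⟨hx, t, fun k => pair 0 (w k), ht, ht0, tendsto_pair tendsto_const_nhds hw, fun k => ?_⟩
  simpa [svGraph] using hmem k

theorem neg_svDom_regularCoderiv_subset (hx : xbar ∈ M ybar) :
    -svDom (regularCoderiv M ybar xbar) ⊆ regularNormalCone (M ybar) xbar := by
  rintro p ⟨ys, -, hys⟩
  refine ⟨hx, fun u hu => ?_⟩
  have := hys _ (tangentCone_image_subset hu)
  rw [inner_pair] at this
  simpa using this

end Product

/-! ### From `FOSCclm` to a Lipschitz-like property and calmness -/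

section Lipschitz

variable {Y X : Type*} [NormedAddCommGroup Y] [InnerProductSpace ℝ Y] [FiniteDimensional ℝ Y]
  [NormedAddCommGroup X] [InnerProductSpace ℝ X] [FiniteDimensional ℝ X]
  {M : Y → Set X} {ybar : Y} {xbar : X}

/-- Under `FOSCclm`, regular normals to the graph satisfy a uniform coderivative estimate in a
cone around the directions `(0, u)`. -/
theorem FOSCclm.exists_norm_fst_le (h : FOSCclm M ybar xbar) (hx : xbar ∈ M ybar) :
    ∃ ε > 0, ∃ κ > 0, ∀ z ∈ svGraph M, 0 < ‖z.snd - xbar‖ → ‖z.snd - xbar‖ < ε →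
      ‖z.fst - ybar‖ ≤ ε * ‖z.snd - xbar‖ →
      ∀ p ∈ regularNormalCone (svGraph M) z, ‖p.fst‖ ≤ κ * ‖p.snd‖ := by
  by_contra! hcon
  have hpos : ∀ k : ℕ, (0 : ℝ) < 1 / ((k : ℝ) + 1) := fun k => by positivity
  choose z hz hz0 hzs hzf p hp hpn using fun k : ℕ =>
    hcon (1 / ((k : ℝ) + 1)) (hpos k) ((k : ℝ) + 1) (by positivity)
  have hpf : ∀ k, 0 < ‖(p k).fst‖ := fun k =>
    lt_of_le_of_lt (by positivity) (hpn k)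
  have hs0 : Tendsto (fun k => ‖(z k).snd - xbar‖) atTop (𝓝 0) :=
    squeeze_zero (fun k => norm_nonneg _) (fun k => (hzs k).le) tendsto_one_div_nat_succ
  -- Normalizing z by ‖z.snd - xbar‖ and p by ‖p.fst‖ gives limits (0, u) and (ys, 0) with u and ys
  -- of norm one, which contradicts `FOSCclm`.
  obtain ⟨⟨u, ys⟩, hus, φ, hφ, hlim⟩ :=
    ((isCompact_sphere (0 : X) 1).prod (isCompact_sphere (0 : Y) 1)).tendsto_subseq
    (x := fun k => (‖(z k).snd - xbar‖⁻¹ • ((z k).snd - xbar), ‖(p k).fst‖⁻¹ • (p k).fst))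
    (fun k => by
      constructor
      · simp [norm_smul, inv_mul_cancel₀ (hz0 k).ne']
      · simp [norm_smul, inv_mul_cancel₀ (hpf k).ne'])
  have hu : ‖u‖ = 1 := by simpa using hus.1
  have hys : ‖ys‖ = 1 := by simpa using hus.2
  have hlu := (continuous_fst.tendsto _).comp hlim
  have hly := (continuous_snd.tendsto _).comp hlim
  have hv : Tendsto (fun k => ‖(z k).snd - xbar‖⁻¹ • ((z k).fst - ybar)) atTop (𝓝 0) := by
    refine squeeze_zero_norm (fun k => ?_) tendsto_one_div_nat_succ
    rw [norm_smul, norm_inv, norm_norm, inv_mul_le_iff₀ (hz0 k), mul_comm]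
    exact hzf k
  have hq : Tendsto (fun k => ‖(p k).fst‖⁻¹ • (p k).snd) atTop (𝓝 0) := by
    refine squeeze_zero_norm (fun k => ?_) tendsto_one_div_nat_succ
    rw [norm_smul, norm_inv, norm_norm, inv_mul_le_iff₀ (hpf k), mul_one_div, le_div_iff₀
      (by positivity), mul_comm]
    exact (hpn k).le
  have hdir : Tendsto (fun k => ‖(z (φ k)).snd - xbar‖⁻¹ • (z (φ k) - pair ybar xbar)) atTop
      (𝓝 (pair 0 u)) := tendsto_pair (hv.comp hφ.tendsto_atTop) hlu
  have hnor : Tendsto (fun k => ‖(p (φ k)).fst‖⁻¹ • p (φ k)) atTop (𝓝 (pair ys 0)) :=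
    tendsto_pair hly (hq.comp hφ.tendsto_atTop)
  have hxG : pair ybar xbar ∈ svGraph M := hx
  have hmem : u ∈ graphicalDeriv M ybar xbar 0 :=
    mem_tangentCone_of_tendsto_smul_sub hxG (Eventually.of_forall fun k => hz0 (φ k))
      (hs0.comp hφ.tendsto_atTop) hdir (Eventually.of_forall fun k => hz (φ k))
  have hmem' : ys ∈ dirLimitingCoderiv M ybar xbar 0 u 0 := by
    change pair ys (-(0 : X)) ∈ dirLimitingNormalCone (svGraph M) (pair ybar xbar) (pair 0 u)
    rw [neg_zero]
    exact mem_dirLimitingNormalCone_of_tendsto_smul_sub hxG (fun k => hz0 (φ k))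
      (hs0.comp hφ.tendsto_atTop) hdir hnor
      (fun k => smul_mem_regularNormalCone (hp _) (inv_nonneg.2 (norm_nonneg _)))
  rw [h u ⟨hmem, by rintro rfl; simp at hu⟩] at hmem'
  rw [Set.mem_singleton_iff.1 hmem'] at hys
  simp at hys

/-- A uniform estimate for the regular normals to a closed graph around one of its points implies
that nearby images contain points at a linearly controlled distance. -/
theorem exists_mem_norm_sub_le_of_norm_fst_le {z₀ : WithLp 2 (Y × X)} {r κ : ℝ}
    (hz₀ : z₀ ∈ svGraph M) (hκ : 0 < κ)
    (hcl : IsClosed (svGraph M ∩ Metric.closedBall z₀ r))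
    (hnor : ∀ z ∈ svGraph M, ‖z - z₀‖ ≤ r →
      ∀ p ∈ regularNormalCone (svGraph M) z, ‖p.fst‖ ≤ κ * ‖p.snd‖)
    {y : Y} (hy : (2 + 3 * κ) * ‖y - z₀.fst‖ < r) :
    ∃ x ∈ M y, ‖x - z₀.snd‖ ≤ 3 * κ * ‖y - z₀.fst‖ := by
  rcases eq_or_ne y z₀.fst with rfl | hne
  · exact ⟨z₀.snd, hz₀, by simp⟩
  have hd : 0 < ‖y - z₀.fst‖ := norm_pos_iff.2 (sub_ne_zero.2 hne)
  set d := ‖y - z₀.fst‖ with hdd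
  have hr : 0 < r := lt_of_le_of_lt (by positivity) hy
  -- The functional minimized below has value d at z₀, so a minimizer satisfies ‖z.snd - z₀.snd‖² ≤
  -- d / a = 8κ²d² < (3κd)². The same weight gives κ · a · 3κd = 3/8 < 1/2, the final contradiction.
  set a : ℝ := 1 / (8 * κ ^ 2 * d) with ha
  have ha0 : 0 < a := by positivity
  have had : a * (8 * κ ^ 2 * d) = 1 := by rw [ha]; field_simp
  have hK : IsCompact (svGraph M ∩ Metric.closedBall z₀ r) :=
    (isCompact_closedBall z₀ r).of_isClosed_subset hcl Set.inter_subset_right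
  obtain ⟨z, ⟨hzG, hzb⟩, hzmin⟩ := hK.exists_isMinOn
    (f := fun z => ‖z.fst - y‖ + a * ‖z.snd - z₀.snd‖ ^ 2)
    ⟨z₀, hz₀, Metric.mem_closedBall_self hr.le⟩
    (by
      have h1 := WithLp.continuous_fst 2 Y X
      have h2 := WithLp.continuous_snd 2 Y X
      fun_prop)
  have hle : ∀ w ∈ svGraph M, ‖w - z₀‖ ≤ r →
      ‖z.fst - y‖ + a * ‖z.snd - z₀.snd‖ ^ 2 ≤ ‖w.fst - y‖ + a * ‖w.snd - z₀.snd‖ ^ 2 :=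
    fun w hw hwr => hzmin ⟨hw, mem_closedBall_iff_norm.2 hwr⟩
  have h0 : ‖z.fst - y‖ + a * ‖z.snd - z₀.snd‖ ^ 2 ≤ d := by
    have := hle z₀ hz₀ (by simpa using hr.le)
    rw [norm_sub_rev z₀.fst y] at this
    simpa [← hdd] using this
  have hfd : ‖z.fst - y‖ ≤ d := by nlinarith [sq_nonneg ‖z.snd - z₀.snd‖]
  have hsq : a * ‖z.snd - z₀.snd‖ ^ 2 ≤ d := by linarith [norm_nonneg (z.fst - y)]
  have hsq' : ‖z.snd - z₀.snd‖ ^ 2 ≤ 8 * κ ^ 2 * d ^ 2 := by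
    have := mul_le_mul_of_nonneg_right hsq (by positivity : 0 ≤ 8 * κ ^ 2 * d)
    nlinarith
  have hsd : ‖z.snd - z₀.snd‖ < 3 * κ * d := by
    refine lt_of_pow_lt_pow_left₀ 2 (by positivity) (hsq'.trans_lt ?_)
    have : 0 < κ ^ 2 * d ^ 2 := by positivity
    nlinarith
  have hzz : ‖z - z₀‖ < r := by
    refine (norm_le_norm_fst_add_norm_snd _).trans_lt ?_
    have : ‖(z - z₀).fst‖ ≤ 2 * d := by
      calc ‖(z - z₀).fst‖ = ‖(z.fst - y) + (y - z₀.fst)‖ := by congr 1; simp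
        _ ≤ _ := (norm_add_le _ _).trans (by linarith)
    have h2 : ‖(z - z₀).snd‖ < 3 * κ * d := by simpa using hsd
    linarith
  by_cases hzy : z.fst = y
  · exact ⟨z.snd, hzy ▸ hzG, hsd.le⟩
  exfalso
  have hc : 0 < ‖z.fst - y‖ := norm_pos_iff.2 (sub_ne_zero.2 hzy)
  set c := ‖z.fst - y‖ with hcc
  have hN := mem_regularNormalCone_of_isLocalMin hzG (a := 1 / (2 * c)) (b := a) (p := y)
    (q := z₀.snd) (by
      have hev : ∀ᶠ w in 𝓝 z, w ∈ Metric.ball z₀ r :=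
        Metric.isOpen_ball.mem_nhds (mem_ball_iff_norm.2 hzz)
      filter_upwards [hev] with w hw hwG
      have h1 := hle w hwG (mem_ball_iff_norm.1 hw).le
      -- The norm is replaced by a quadratic majorant that agrees with it where ‖w.fst - y‖ = c, in
      -- particular at z, so z stays a local minimizer.
      have h2 : ‖w.fst - y‖ ≤ 1 / (2 * c) * ‖w.fst - y‖ ^ 2 + c / 2 := by
        have : 1 / (2 * c) * ‖w.fst - y‖ ^ 2 + c / 2 - ‖w.fst - y‖ =
            (‖w.fst - y‖ - c) ^ 2 / (2 * c) := by field_simp; ring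
        have h3 : 0 ≤ (‖w.fst - y‖ - c) ^ 2 / (2 * c) := by positivity
        linarith
      have h3 : 1 / (2 * c) * c ^ 2 = c / 2 := by field_simp
      rw [← hcc, h3]
      linarith)
  have hb := hnor z hzG hzz.le _ hN
  simp only [pair, WithLp.toLp_fst, WithLp.toLp_snd] at hb
  rw [norm_smul, norm_smul, norm_sub_rev y, ← hcc, norm_sub_rev z₀.snd, Real.norm_eq_abs,
    Real.norm_eq_abs, abs_of_pos ha0, abs_of_pos (by positivity)] at hb
  have h3 : 1 / (2 * c) * c = 1 / 2 := by field_simp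
  rw [h3] at hb
  have h4 : κ * (a * ‖z.snd - z₀.snd‖) < κ * (a * (3 * κ * d)) := by gcongr
  have h5 : κ * (a * (3 * κ * d)) = 3 / 8 := by linear_combination (3 / 8) * had
  linarith

/-- `FOSCclm` implies a Lipschitz-like property in a cone around the directions `(0, u)`. -/
theorem FOSCclm.exists_lipschitzLike (h : FOSCclm M ybar xbar) (hx : xbar ∈ M ybar)
    (hcl : LocallyClosedAround (svGraph M) (pair ybar xbar)) :
    ∃ ε > 0, ∃ κ > 0, ∀ y x, x ∈ M y → 0 < ‖x - xbar‖ → ‖x - xbar‖ < ε →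
      ‖y - ybar‖ ≤ ε * ‖x - xbar‖ → ∀ y', ‖y' - ybar‖ ≤ ε * ‖x - xbar‖ →
        ∃ x' ∈ M y', ‖x' - x‖ ≤ κ * ‖y' - y‖ := by
  obtain ⟨ε₀, hε₀, κ, hκ, hest⟩ := h.exists_norm_fst_le hx
  obtain ⟨ρ, hρ, hclb⟩ := hcl.exists_forall_closedBall
  obtain ⟨ε, hε, hεε, hε1, hερ⟩ : ∃ ε > 0, ε ≤ ε₀ ∧ ε ≤ 1 ∧ ε ≤ ρ :=
    ⟨min ε₀ (min 1 ρ), by positivity, min_le_left _ _, (min_le_right _ _).trans (min_le_left _ _),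
      (min_le_right _ _).trans (min_le_right _ _)⟩
  have hC : (0 : ℝ) < 9 * (2 + 3 * κ) := by positivity
  -- The ball of radius εs/4 around (y, x) must stay in the cone where the normals are controlled.
  -- Since ‖y' - y‖ ≤ 2δs, a factor 8 would give (2 + 3κ)‖y' - y‖ ≤ εs/4; the factor 9 makes this
  -- strict.
  obtain ⟨δ, hδ, hδε, hδC⟩ : ∃ δ > 0, δ ≤ ε / 4 ∧ 9 * (2 + 3 * κ) * δ ≤ ε := by
    refine ⟨min (ε / 4) (ε / (9 * (2 + 3 * κ))), by positivity, min_le_left _ _, ?_⟩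
    calc _ ≤ 9 * (2 + 3 * κ) * (ε / (9 * (2 + 3 * κ))) := by gcongr; exact min_le_right _ _
      _ = ε := by field_simp
  refine ⟨δ, hδ, 3 * κ, by positivity, fun y x hxy hs0 hsδ hyδ y' hy' => ?_⟩
  set s := ‖x - xbar‖ with hs
  have hyε : ‖y - ybar‖ ≤ ε / 4 * s := hyδ.trans (by gcongr)
  have hεs : 0 < ε * s := by positivity
  refine exists_mem_norm_sub_le_of_norm_fst_le (z₀ := pair y x) (r := ε * s / 4) hxy hκ
    (hclb _ _ ?_) (fun z hz hzr => hest z hz ?_ ?_ ?_) ?_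
  · have h1 := norm_le_norm_fst_add_norm_snd (pair y x - pair ybar xbar)
    simp only [pair, WithLp.sub_fst, WithLp.sub_snd, WithLp.toLp_fst, WithLp.toLp_snd, ← hs] at h1
    nlinarith
  all_goals try
    have hf : ‖z.fst - y‖ ≤ ε * s / 4 := (WithLp.norm_fst_le Y (z - pair y x)).trans hzr
    have hn : ‖z.snd - x‖ ≤ ε * s / 4 := (WithLp.norm_snd_le Y (z - pair y x)).trans hzr
    have e1 : z.snd - xbar = (z.snd - x) + (x - xbar) := by abel
    have e2 : z.fst - ybar = (z.fst - y) + (y - ybar) := by abel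
    have l1 : ‖z.snd - xbar‖ ≤ ε * s / 4 + s := by
      rw [e1]; exact (norm_add_le _ _).trans (by linarith)
    have l2 : s - ε * s / 4 ≤ ‖z.snd - xbar‖ := by
      have := norm_sub_le (z.snd - xbar) (z.snd - x)
      rw [show z.snd - xbar - (z.snd - x) = x - xbar by abel] at this
      linarith
    have l3 : ‖z.fst - ybar‖ ≤ ε * s / 2 := by
      rw [e2]; exact (norm_add_le _ _).trans (by linarith)
    have l4 : ε * s ≤ s := by nlinarith
  · linarith
  · nlinarith
  · refine l3.trans ?_
    have : ε * (s / 2) ≤ ε₀ * ‖z.snd - xbar‖ :=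
      mul_le_mul hεε (by linarith) (by positivity) hε₀.le
    linarith
  · have h1 : ‖y' - y‖ ≤ 2 * δ * s := by
      rw [show y' - y = (y' - ybar) - (y - ybar) by abel]
      exact (norm_sub_le _ _).trans (by linarith)
    change (2 + 3 * κ) * ‖y' - y‖ < _
    have h2 : (2 + 3 * κ) * ‖y' - y‖ ≤ (2 + 3 * κ) * (2 * δ * s) := by gcongr
    have h3 : 9 * (2 + 3 * κ) * δ * s ≤ ε * s := by gcongr
    nlinarith

/-- `FOSCclm` implies calmness. -/
theorem FOSCclm.exists_calm (h : FOSCclm M ybar xbar) (hx : xbar ∈ M ybar)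
    (hcl : LocallyClosedAround (svGraph M) (pair ybar xbar)) :
    ∃ ε > 0, ∃ κ > 0, ∀ y x, x ∈ M y → ‖x - xbar‖ < ε →
        ∃ x' ∈ M ybar, ‖x' - x‖ ≤ κ * ‖y - ybar‖ := by
  obtain ⟨ε, hε, κ, hκ, hL⟩ := h.exists_lipschitzLike hx hcl
  refine ⟨ε, hε, κ + 1 / ε, by positivity, fun y x hxy hxε => ?_⟩
  -- Outside the cone, ‖x - xbar‖ ≤ ‖y - ybar‖ / ε, so xbar itself serves as x'.
  by_cases hc : 0 < ‖x - xbar‖ ∧ ‖y - ybar‖ ≤ ε * ‖x - xbar‖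
  · obtain ⟨x', hx', hle⟩ := hL y x hxy hc.1 hxε hc.2 ybar (by simp; positivity)
    refine ⟨x', hx', hle.trans ?_⟩
    rw [norm_sub_rev]
    gcongr
    simp [hε.le]
  · refine ⟨xbar, hx, ?_⟩
    have : ‖x - xbar‖ ≤ 1 / ε * ‖y - ybar‖ := by
      rw [one_div, ← div_eq_inv_mul, le_div_iff₀ hε]
      by_contra! hlt
      rcases (norm_nonneg (x - xbar)).eq_or_lt with h0 | h0
      · rw [← h0] at hlt; simp at hlt; exact absurd hlt (not_lt.2 (norm_nonneg _))
      · exact hc ⟨h0, by linarith⟩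
    rw [norm_sub_rev]
    nlinarith [norm_nonneg (y - ybar)]

end Lipschitz

/-! ### Tangents and normals to an image -/

section ImageNormals

variable {Y X : Type*} [NormedAddCommGroup Y] [InnerProductSpace ℝ Y] [FiniteDimensional ℝ Y]
  [NormedAddCommGroup X] [InnerProductSpace ℝ X] [FiniteDimensional ℝ X]
  {M : Y → Set X} {ybar : Y} {xbar : X}

/-- Under calmness, regular normals to an image of a set-valued mapping are approximated by
regular normals to its graph with bounded first component. -/
theorem exists_regularNormalCone_svGraph_near {x : X} {r κ : ℝ} (hr : 0 < r) (hκ : 0 ≤ κ)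
    (hcl : IsClosed (svGraph M ∩ Metric.closedBall (pair ybar x) r))
    (hcalm : ∀ y x₁, x₁ ∈ M y → ‖x₁ - x‖ ≤ r → ∃ x' ∈ M ybar, ‖x' - x₁‖ ≤ κ * ‖y - ybar‖)
    {p : X} (hp : p ∈ regularNormalCone (M ybar) x) {δ : ℝ} (hδ : 0 < δ) :
    ∃ z, ∃ q ∈ regularNormalCone (svGraph M) z,
      ‖z - pair ybar x‖ < δ ∧ ‖q.snd - p‖ < δ ∧ ‖q.fst‖ ≤ κ * (2 + κ) * ‖p‖ := by
  have hxM : pair ybar x ∈ svGraph M := hp.1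
  have hK : IsCompact (svGraph M ∩ Metric.closedBall (pair ybar x) r) :=
    (isCompact_closedBall _ r).of_isClosed_subset hcl Set.inter_subset_right
  set t : ℕ → ℝ := fun k => 1 / ((k : ℝ) + 1) with htdef
  have ht : ∀ k, 0 < t k := fun k => by positivity
  have ht1 : ∀ k, t k ≤ 1 := fun k => by
    rw [htdef]
    simp only
    rw [div_le_one (by positivity)]
    linarith [(Nat.cast_nonneg k : (0 : ℝ) ≤ k)]
  have ht0 : Tendsto t atTop (𝓝 0) := tendsto_one_div_nat_succ
  -- The target x + t p makes the second component of the resulting normal equal to p - (z.snd - x)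
  -- / t. Comparison with (ybar, x) gives ‖z.fst - ybar‖ ≤ t²‖p‖, so the correction by calmness is
  -- o(t).
  have hmin : ∀ k, ∃ z ∈ svGraph M, ‖z - pair ybar x‖ ≤ r ∧
      ∀ w ∈ svGraph M, ‖w - pair ybar x‖ ≤ r →
        1 / t k ^ 3 * ‖z.fst - ybar‖ ^ 2 + 1 / t k * ‖z.snd - (x + t k • p)‖ ^ 2 ≤
        1 / t k ^ 3 * ‖w.fst - ybar‖ ^ 2 + 1 / t k * ‖w.snd - (x + t k • p)‖ ^ 2 := by
    intro k
    obtain ⟨z, ⟨hzG, hzb⟩, hzmin⟩ := hK.exists_isMinOn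
      (f := fun z => 1 / t k ^ 3 * ‖z.fst - ybar‖ ^ 2 + 1 / t k * ‖z.snd - (x + t k • p)‖ ^ 2)
      ⟨pair ybar x, hxM, Metric.mem_closedBall_self hr.le⟩
      (by
        have h1 := WithLp.continuous_fst 2 Y X
        have h2 := WithLp.continuous_snd 2 Y X
        fun_prop)
    exact ⟨z, hzG, mem_closedBall_iff_norm.1 hzb,
      fun w hw hwr => hzmin ⟨hw, mem_closedBall_iff_norm.2 hwr⟩⟩
  choose z hzG hzr hzmin using hmin
  have hval : ∀ k, 1 / t k ^ 3 * ‖(z k).fst - ybar‖ ^ 2 +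
      1 / t k * ‖(z k).snd - (x + t k • p)‖ ^ 2 ≤ t k * ‖p‖ ^ 2 := fun k => by
    have h := hzmin k (pair ybar x) hxM (by simpa using hr.le)
    simp only [pair, WithLp.toLp_fst, WithLp.toLp_snd, sub_self, norm_zero, sub_add_cancel_left,
      norm_neg, norm_smul, Real.norm_eq_abs, abs_of_pos (ht k)] at h
    refine h.trans (le_of_eq ?_)
    have := (ht k).ne'
    field_simp
    ring
  have hy : ∀ k, ‖(z k).fst - ybar‖ ≤ t k ^ 2 * ‖p‖ := fun k => by
    have hk := ht k
    refine le_of_sq_le_sq ?_ (by positivity)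
    have h1 : 1 / t k ^ 3 * ‖(z k).fst - ybar‖ ^ 2 ≤ t k * ‖p‖ ^ 2 :=
      (le_add_of_nonneg_right (by positivity)).trans (hval k)
    rw [one_div, inv_mul_le_iff₀ (by positivity)] at h1
    exact h1.trans (le_of_eq (by ring))
  have hxp : ∀ k, ‖(z k).snd - (x + t k • p)‖ ≤ t k * ‖p‖ := fun k => by
    have hk := ht k
    refine le_of_sq_le_sq ?_ (by positivity)
    have h1 : 1 / t k * ‖(z k).snd - (x + t k • p)‖ ^ 2 ≤ t k * ‖p‖ ^ 2 :=
      (le_add_of_nonneg_left (by positivity)).trans (hval k)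
    rw [one_div, inv_mul_le_iff₀ hk] at h1
    exact h1.trans (le_of_eq (by ring))
  have hx : ∀ k, ‖(z k).snd - x‖ ≤ 2 * (t k * ‖p‖) := fun k => by
    calc ‖(z k).snd - x‖ = ‖((z k).snd - (x + t k • p)) + t k • p‖ := by congr 1; abel
      _ ≤ _ := (norm_add_le _ _).trans (by
        rw [norm_smul, Real.norm_eq_abs, abs_of_pos (ht k)]; linarith [hxp k])
  choose x' hx'M hx' using fun k => hcalm _ _ (hzG k) ((WithLp.norm_snd_le Y _).trans (hzr k))
  have hx'0 : ∀ k, ‖x' k - (z k).snd‖ ≤ κ * (t k ^ 2 * ‖p‖) := fun k =>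
    (hx' k).trans (by gcongr; exact hy k)
  have hzlim : Tendsto (fun k => ‖z k - pair ybar x‖) atTop (𝓝 0) := by
    refine squeeze_zero (fun _ => norm_nonneg _)
      (g := fun k => t k ^ 2 * ‖p‖ + 2 * (t k * ‖p‖)) (fun k => ?_) ?_
    · exact (norm_le_norm_fst_add_norm_snd _).trans (add_le_add (hy k) (hx k))
    · simpa using ((ht0.pow 2).mul_const ‖p‖).add ((ht0.mul_const ‖p‖).const_mul 2)
  have hx'lim : Tendsto (fun k => ‖x' k - x‖) atTop (𝓝 0) := by
    refine squeeze_zero (fun _ => norm_nonneg _)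
      (g := fun k => κ * (t k ^ 2 * ‖p‖) + 2 * (t k * ‖p‖)) (fun k => ?_) ?_
    · rw [← sub_add_sub_cancel]
      exact (norm_add_le _ _).trans (add_le_add (hx'0 k) (hx k))
    · simpa using (((ht0.pow 2).mul_const ‖p‖).const_mul κ).add ((ht0.mul_const ‖p‖).const_mul 2)
  -- the difference quotients of `(z k).snd` at `x` tend to zero along a subsequence
  obtain ⟨w, -, φ, hφ, hw⟩ := (isCompact_closedBall (0 : X) (2 * ‖p‖)).tendsto_subseq
    (x := fun k => (t k)⁻¹ • ((z k).snd - x)) (fun k => by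
      rw [mem_closedBall_zero_iff, norm_smul, norm_inv, Real.norm_eq_abs, abs_of_pos (ht k),
        inv_mul_le_iff₀ (ht k)]
      exact (hx k).trans (le_of_eq (by ring)))
  have hdiff : Tendsto (fun k => (t k)⁻¹ • (x' k - (z k).snd)) atTop (𝓝 0) := by
    refine squeeze_zero_norm (a := fun k => κ * (t k * ‖p‖)) (fun k => ?_) ?_
    · rw [norm_smul, norm_inv, Real.norm_eq_abs, abs_of_pos (ht k), inv_mul_le_iff₀ (ht k)]
      exact (hx'0 k).trans (le_of_eq (by ring))
    · simpa using (ht0.mul_const ‖p‖).const_mul κ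
  have hwT : w ∈ tangentCone (M ybar) x := by
    refine mem_tangentCone_of_tendsto_smul_sub (t := t ∘ φ) (z' := x' ∘ φ) hp.1
      (Eventually.of_forall fun k => ht _) (ht0.comp hφ.tendsto_atTop) ?_
      (Eventually.of_forall fun k => hx'M _)
    have := hw.add (hdiff.comp hφ.tendsto_atTop)
    rw [add_zero] at this
    refine this.congr fun k => ?_
    simp only [Function.comp_apply, ← smul_add]
    congr 1
    abel
  have hwp : ‖w - p‖ ≤ ‖p‖ := by
    refine le_of_tendsto (hw.sub_const p).norm (Eventually.of_forall fun k => ?_)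
    have hk := ht (φ k)
    have : (t (φ k))⁻¹ • ((z (φ k)).snd - x) - p =
        (t (φ k))⁻¹ • ((z (φ k)).snd - (x + t (φ k) • p)) := by
      rw [← sub_sub, smul_sub _ _ (t (φ k) • p), inv_smul_smul₀ hk.ne']
    simp only [Function.comp_apply]
    rw [this, norm_smul, norm_inv, Real.norm_eq_abs, abs_of_pos hk, inv_mul_le_iff₀ hk]
    exact hxp _
  -- Since p is normal and w tangent, ⟨p, w⟩ ≤ 0; expanding ‖w - p‖² ≤ ‖p‖² then forces w = 0.
  have hw0 : w = 0 := by
    have h1 := hp.2 w hwT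
    have h2 : ‖w - p‖ ^ 2 ≤ ‖p‖ ^ 2 := by gcongr
    rw [norm_sub_sq_real, real_inner_comm] at h2
    have : ‖w‖ ^ 2 ≤ 0 := by linarith
    simpa using this.antisymm (by positivity)
  subst hw0
  have e1 : ∀ᶠ k in atTop, ‖z (φ k) - pair ybar x‖ < min r δ :=
    (hzlim.comp hφ.tendsto_atTop).eventually_lt_const (by positivity)
  have e2 : ∀ᶠ k in atTop, ‖x' (φ k) - x‖ < r :=
    (hx'lim.comp hφ.tendsto_atTop).eventually_lt_const hr
  have e3 : ∀ᶠ k in atTop, ‖(t (φ k))⁻¹ • ((z (φ k)).snd - x)‖ < δ := by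
    have := hw.norm
    rw [norm_zero] at this
    exact this.eventually_lt_const hδ
  obtain ⟨k', h1, h2, h3⟩ := (e1.and (e2.and e3)).exists
  generalize φ k' = k at h1 h2 h3
  have hk := ht k
  refine ⟨z k, _, mem_regularNormalCone_of_isLocalMin (hzG k) (a := 1 / t k ^ 3) (b := 1 / t k)
    (p := ybar) (q := x + t k • p) ?_, h1.trans_le (min_le_right _ _), ?_, ?_⟩
  · have : ∀ᶠ w in 𝓝 (z k), w ∈ Metric.ball (pair ybar x) r :=
      Metric.isOpen_ball.mem_nhds (mem_ball_iff_norm.2 (h1.trans_le (min_le_left _ _)))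
    filter_upwards [this] with w hw hwG using hzmin k w hwG (mem_ball_iff_norm.1 hw).le
  · have : (1 / t k) • (x + t k • p - (z k).snd) - p = -((t k)⁻¹ • ((z k).snd - x)) := by
      rw [one_div, add_sub_right_comm, smul_add, inv_smul_smul₀ hk.ne', add_sub_cancel_right,
        ← smul_neg, neg_sub]
    simp only [pair, WithLp.toLp_snd]
    rw [this, norm_neg]
    exact h3
  · simp only [pair, WithLp.toLp_fst]
    rw [norm_smul, Real.norm_eq_abs, abs_of_pos (by positivity), norm_sub_rev]
    -- Comparison with the calm correction (ybar, x') gives A²/t³ + B²/t ≤ (κA + B)²/t. The B² terms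
    -- cancel, and dividing by A bounds A/t³, the norm of the first component.
    have hc := hzmin k (pair ybar (x' k)) (hx'M k) (by
      refine (norm_le_norm_fst_add_norm_snd _).trans ?_
      simpa using h2.le)
    simp only [pair, WithLp.toLp_fst, WithLp.toLp_snd, sub_self, norm_zero] at hc
    have hx'p : ‖x' k - (x + t k • p)‖ ≤
        κ * ‖(z k).fst - ybar‖ + ‖(z k).snd - (x + t k • p)‖ := by
      rw [← sub_add_sub_cancel]
      exact (norm_add_le _ _).trans (by gcongr; exact hx' k)
    set A := ‖(z k).fst - ybar‖
    set B := ‖(z k).snd - (x + t k • p)‖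
    have hA0 : 0 ≤ A := norm_nonneg _
    have hB0 : 0 ≤ B := norm_nonneg _
    rcases hA0.eq_or_lt with hA | hA
    · rw [← hA]; simp; positivity
    have h4 : 1 / t k * ‖x' k - (x + t k • p)‖ ^ 2 ≤ 1 / t k * (κ * A + B) ^ 2 := by gcongr
    have h5 : 1 / t k ^ 3 * A ^ 2 ≤ 1 / t k * (κ * (κ * A + 2 * B)) * A := by nlinarith
    have h6 : 1 / t k ^ 3 * A ≤ 1 / t k * (κ * (κ * A + 2 * B)) :=
      le_of_mul_le_mul_right (by linarith) hA
    refine h6.trans ?_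
    have h7 : κ * A + 2 * B ≤ t k * ((2 + κ) * ‖p‖) := by
      have := hy k
      have := hxp k
      have : t k ^ 2 * ‖p‖ ≤ t k * ‖p‖ := by
        gcongr
        nlinarith [ht1 k]
      have : κ * A ≤ κ * (t k * ‖p‖) := by gcongr; linarith
      linarith
    calc 1 / t k * (κ * (κ * A + 2 * B)) ≤ 1 / t k * (κ * (t k * ((2 + κ) * ‖p‖))) := by gcongr
      _ = κ * (2 + κ) * ‖p‖ := by field_simp

/-- Under `FOSCclm`, convergent sequences of regular normals to an image are, along a subsequence,
limits of regular normals to the graph at arbitrarily close points. -/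
theorem FOSCclm.exists_subseq_regularNormalCone (h : FOSCclm M ybar xbar) (hx : xbar ∈ M ybar)
    (hcl : LocallyClosedAround (svGraph M) (pair ybar xbar)) {x' p' : ℕ → X} {p : X}
    (hx' : Tendsto x' atTop (𝓝 xbar)) (hp' : Tendsto p' atTop (𝓝 p))
    (hmem : ∀ k, p' k ∈ regularNormalCone (M ybar) (x' k)) {s : ℕ → ℝ} (hs : ∀ k, 0 < s k) :
    ∃ (φ : ℕ → ℕ) (z q : ℕ → WithLp 2 (Y × X)) (ys : Y), StrictMono φ ∧
      (∀ k, ‖z k - pair ybar (x' (φ k))‖ < s (φ k)) ∧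
      (∀ k, q k ∈ regularNormalCone (svGraph M) (z k)) ∧
      Tendsto q atTop (𝓝 (pair ys p)) := by
  obtain ⟨ε, hε, κ, hκ, hcalm⟩ := h.exists_calm hx hcl
  obtain ⟨ρ, hρ, hclb⟩ := hcl.exists_forall_closedBall
  obtain ⟨r, hr, hrε, hrρ⟩ : ∃ r > 0, r ≤ ε / 2 ∧ r ≤ ρ / 2 :=
    ⟨min (ε / 2) (ρ / 2), by positivity, min_le_left _ _, min_le_right _ _⟩
  set C := κ * (2 + κ) * (‖p‖ + 1)
  have hev : ∀ᶠ k in atTop, ∃ z, ∃ q ∈ regularNormalCone (svGraph M) z,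
      ‖z - pair ybar (x' k)‖ < s k ∧ ‖q.snd - p' k‖ < 1 / ((k : ℝ) + 1) ∧ ‖q.fst‖ ≤ C := by
    have e1 : ∀ᶠ k in atTop, ‖x' k - xbar‖ < r :=
      (tendsto_iff_norm_sub_tendsto_zero.1 hx').eventually_lt_const hr
    have e2 : ∀ᶠ k in atTop, ‖p' k‖ < ‖p‖ + 1 := hp'.norm.eventually_lt_const (by linarith)
    filter_upwards [e1, e2] with k h1 h2
    obtain ⟨z, q, hq, hz, hqp, hqf⟩ := exists_regularNormalCone_svGraph_near hr hκ.le
      (hclb (pair ybar (x' k)) r (by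
        have := norm_le_norm_fst_add_norm_snd (pair ybar (x' k) - pair ybar xbar)
        simp only [pair, WithLp.sub_fst, WithLp.sub_snd, WithLp.toLp_fst, WithLp.toLp_snd,
          sub_self, norm_zero] at this
        linarith))
      (fun y x₁ hx₁ hx₁r => hcalm y x₁ hx₁ (by
        rw [← sub_add_sub_cancel]
        exact (norm_add_le _ _).trans_lt (by linarith))) (hmem k)
      (δ := min (s k) (1 / ((k : ℝ) + 1))) (lt_min (hs k) (by positivity))
    exact ⟨z, q, hq, hz.trans_le (min_le_left _ _), hqp.trans_le (min_le_right _ _),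
      hqf.trans (mul_le_mul_of_nonneg_left h2.le (by positivity))⟩
  obtain ⟨φ, hφ, hex⟩ := extraction_of_eventually_atTop hev
  choose z q hq hz hqp hqf using hex
  obtain ⟨ys, -, ψ, hψ, hys⟩ := (isCompact_closedBall (0 : Y) C).tendsto_subseq
    (x := fun k => (q k).fst) (fun k => mem_closedBall_zero_iff.2 (hqf k))
  have h0 : Tendsto (fun k => (q k).snd - p' (φ k)) atTop (𝓝 0) :=
    squeeze_zero_norm (fun k => (hqp k).le) (tendsto_one_div_nat_succ.comp hφ.tendsto_atTop)
  have hqs : Tendsto (fun k => (q k).snd) atTop (𝓝 p) := by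
    simpa using h0.add (hp'.comp hφ.tendsto_atTop)
  exact ⟨φ ∘ ψ, z ∘ ψ, q ∘ ψ, ys, hφ.comp hψ, fun k => hz _, fun k => hq _,
    tendsto_pair hys (hqs.comp hψ.tendsto_atTop)⟩

/-- For a tangent (0, u), calmness moves the approximating points into M(ybar) at cost κ t‖w.fst‖ =
o(t), because w.fst → 0. -/
theorem FOSCclm.tangentCone_image (h : FOSCclm M ybar xbar) (hx : xbar ∈ M ybar)
    (hcl : LocallyClosedAround (svGraph M) (pair ybar xbar)) :
    tangentCone (M ybar) xbar = graphicalDeriv M ybar xbar 0 := by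
  refine tangentCone_image_subset.antisymm ?_
  rintro u ⟨-, t, w, ht, ht0, hw, hmem⟩
  obtain ⟨ε, hε, κ, hκ, hcalm⟩ := h.exists_calm hx hcl
  have hmem' : ∀ k, xbar + t k • (w k).snd ∈ M (ybar + t k • (w k).fst) := hmem
  have hws := tendsto_snd hw
  have hwf := tendsto_fst hw
  have hlim : Tendsto (fun k => ‖t k • (w k).snd‖) atTop (𝓝 0) := by
    simpa using (ht0.smul hws).norm
  have hev : ∀ᶠ k in atTop, ∃ x' ∈ M ybar,
      ‖x' - (xbar + t k • (w k).snd)‖ ≤ κ * ‖t k • (w k).fst‖ := by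
    filter_upwards [hlim.eventually_lt_const hε] with k hk
    simpa using hcalm _ _ (hmem' k) (by simpa using hk)
  obtain ⟨φ, hφ, hex⟩ := extraction_of_eventually_atTop hev
  choose x' hx'M hx' using hex
  refine mem_tangentCone_of_tendsto_smul_sub (t := t ∘ φ) (z' := x') hx
    (Eventually.of_forall fun k => ht _) (ht0.comp hφ.tendsto_atTop) ?_
    (Eventually.of_forall hx'M)
  have h0 : Tendsto (fun k => (t (φ k))⁻¹ • (x' k - (xbar + t (φ k) • (w (φ k)).snd))) atTop
      (𝓝 0) := by
    refine squeeze_zero_norm (a := fun k => κ * ‖(w (φ k)).fst‖) (fun k => ?_) ?_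
    · have hk := ht (φ k)
      rw [norm_smul, norm_inv, Real.norm_eq_abs, abs_of_pos hk, inv_mul_le_iff₀ hk]
      refine (hx' k).trans (le_of_eq ?_)
      rw [norm_smul, Real.norm_eq_abs, abs_of_pos hk]
      ring
    · simpa using (hwf.norm.comp hφ.tendsto_atTop).const_mul κ
  have := h0.add (hws.comp hφ.tendsto_atTop)
  rw [zero_add] at this
  refine this.congr fun k => ?_
  simp only [Function.comp_apply]
  rw [← sub_sub, smul_sub _ _ (t (φ k) • _), inv_smul_smul₀ (ht _).ne', sub_add_cancel]

theorem FOSCclm.limitingNormalCone_image_subset (h : FOSCclm M ybar xbar)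
    (hcl : LocallyClosedAround (svGraph M) (pair ybar xbar)) :
    limitingNormalCone (M ybar) xbar ⊆ -svDom (limitingCoderiv M ybar xbar) := by
  rintro p ⟨hx, x', p', hx', hp', hmem⟩
  obtain ⟨φ, z, q, ys, hφ, hz, hq, hlim⟩ := h.exists_subseq_regularNormalCone hx hcl hx' hp' hmem
    (s := fun k => 1 / ((k : ℝ) + 1)) (fun k => by positivity)
  have hxG : pair ybar xbar ∈ svGraph M := hx
  refine ⟨ys, ?_⟩
  change pair ys (- -p) ∈ limitingNormalCone (svGraph M) (pair ybar xbar)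
  rw [neg_neg]
  refine ⟨hxG, z, q, ?_, hlim, hq⟩
  have h0 : Tendsto (fun k => z k - pair ybar (x' (φ k))) atTop (𝓝 0) :=
    squeeze_zero_norm (fun k => (hz k).le) (tendsto_one_div_nat_succ.comp hφ.tendsto_atTop)
  simpa using h0.add
    (tendsto_pair (tendsto_const_nhds (x := ybar)) (hx'.comp hφ.tendsto_atTop))

theorem FOSCclm.dirLimitingNormalCone_image_subset (h : FOSCclm M ybar xbar)
    (hcl : LocallyClosedAround (svGraph M) (pair ybar xbar)) (u : X) :
    dirLimitingNormalCone (M ybar) xbar u ⊆ -svDom (dirLimitingCoderiv M ybar xbar 0 u) := by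
  rintro p ⟨hx, t, w, p', ht, ht0, hw, hp', hmem⟩
  have hx' : Tendsto (fun k => xbar + t k • w k) atTop (𝓝 xbar) := by
    simpa using tendsto_const_nhds.add (ht0.smul hw)
  -- The accuracy t² is o(t), so the new base points keep the direction (0, u).
  obtain ⟨φ, z, q, ys, hφ, hz, hq, hlim⟩ := h.exists_subseq_regularNormalCone hx hcl hx' hp' hmem
    (s := fun k => t k ^ 2) (fun k => pow_pos (ht k) 2)
  have hxG : pair ybar xbar ∈ svGraph M := hx
  refine ⟨ys, ?_⟩
  change pair ys (- -p) ∈ dirLimitingNormalCone (svGraph M) (pair ybar xbar) (pair 0 u)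
  rw [neg_neg]
  refine mem_dirLimitingNormalCone_of_tendsto_smul_sub (t := t ∘ φ) hxG (fun k => ht _)
    (ht0.comp hφ.tendsto_atTop) ?_ hlim hq
  have h0 : Tendsto (fun k => (t (φ k))⁻¹ • (z k - pair ybar (xbar + t (φ k) • w (φ k)))) atTop
      (𝓝 0) := by
    refine squeeze_zero_norm (fun k => ?_) (ht0.comp hφ.tendsto_atTop)
    have hk := ht (φ k)
    rw [norm_smul, norm_inv, Real.norm_eq_abs, abs_of_pos hk, inv_mul_le_iff₀ hk]
    refine (hz k).le.trans (le_of_eq ?_)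
    simp only [Function.comp_apply]
    ring
  have := h0.add (tendsto_pair (tendsto_const_nhds (x := (0 : Y))) (hw.comp hφ.tendsto_atTop))
  rw [zero_add] at this
  refine this.congr fun k => ?_
  have hk := ht (φ k)
  simp only [Function.comp_apply]
  have e : pair ybar (xbar + t (φ k) • w (φ k)) =
      pair ybar xbar + t (φ k) • pair (0 : Y) (w (φ k)) := by
    simp [pair, ← WithLp.toLp_add, ← WithLp.toLp_smul]
  rw [e, ← sub_sub, smul_sub _ _ (t (φ k) • _), inv_smul_smul₀ hk.ne', sub_add_cancel]

end ImageNormals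

/-! ### Inner calmness -/

section InnerCalm

variable {Y X : Type*} [NormedAddCommGroup Y] [NormedAddCommGroup X] {M : Y → Set X}
  {ybar : Y} {xbar : X}

/-- `M` is inner calm at `(ybar, xbar)`: all nearby images contain points whose distance to `xbar`
is linearly controlled. -/
def InnerCalmAt (M : Y → Set X) (ybar : Y) (xbar : X) : Prop :=
  ∃ ε > 0, ∃ κ > 0, ∀ y, ‖y - ybar‖ < ε → ∃ x ∈ M y, ‖x - xbar‖ ≤ κ * ‖y - ybar‖

theorem InnerCalmAt.mem_nhds (h : InnerCalmAt M ybar xbar) : svDom M ∈ 𝓝 ybar := by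
  obtain ⟨ε, hε, κ, -, hM⟩ := h
  filter_upwards [Metric.ball_mem_nhds ybar hε] with y hy
  obtain ⟨x, hx, -⟩ := hM y (mem_ball_iff_norm.1 hy)
  exact ⟨x, hx⟩

end InnerCalm

/-! ### Tangents and normals to the domain -/

section Domain

variable {Y X : Type*} [NormedAddCommGroup Y] [InnerProductSpace ℝ Y]
  [NormedAddCommGroup X] [InnerProductSpace ℝ X] {M : Y → Set X} {ybar : Y} {xbar : X}

theorem svDom_graphicalDeriv_subset :
    svDom (graphicalDeriv M ybar xbar) ⊆ tangentCone (svDom M) ybar := by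
  rintro v ⟨u, hx, t, w, ht, ht0, hw, hmem⟩
  exact ⟨⟨xbar, hx⟩, t, fun k => (w k).fst, ht, ht0, tendsto_fst hw, fun k => ⟨_, hmem k⟩⟩

theorem mem_regularCoderiv_zero_iff {ys : Y} (hx : xbar ∈ M ybar) :
    ys ∈ regularCoderiv M ybar xbar 0 ↔ ys ∈ polarCone (svDom (graphicalDeriv M ybar xbar)) := by
  constructor
  · rintro h v ⟨u, hu⟩
    have := h.2 _ hu
    rw [inner_pair] at this
    simpa using this
  · refine fun h => ⟨hx, fun w hw => ?_⟩
    rw [inner_pair]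
    simpa using h w.fst ⟨w.snd, hw⟩

theorem pair_zero_mem_regularNormalCone_svGraph {ys : Y}
    (h : ys ∈ regularNormalCone (svDom M) ybar) (hx : xbar ∈ M ybar) :
    pair ys (0 : X) ∈ regularNormalCone (svGraph M) (pair ybar xbar) := by
  have : ys ∈ regularCoderiv M ybar xbar 0 :=
    (mem_regularCoderiv_zero_iff hx).2 fun v hv => h.2 v (svDom_graphicalDeriv_subset hv)
  simpa [regularCoderiv] using this

/-- Inner calmness along ybar + t v yields preimages with difference quotients bounded by κ‖v‖; a
cluster point is the required u. -/
theorem InnerCalmAt.nonempty_graphicalDeriv [FiniteDimensional ℝ X]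
    (h : InnerCalmAt M ybar xbar) (hx : xbar ∈ M ybar) (v : Y) :
    (graphicalDeriv M ybar xbar v).Nonempty := by
  obtain ⟨ε, hε, κ, -, hM⟩ := h
  set t : ℕ → ℝ := fun k => 1 / ((k : ℝ) + 1)
  have ht : ∀ k, 0 < t k := fun k => by positivity
  have ht0 : Tendsto t atTop (𝓝 0) := tendsto_one_div_nat_succ
  have hlim : Tendsto (fun k => ‖t k • v‖) atTop (𝓝 0) := by
    simpa using (ht0.smul_const v).norm
  have hev : ∀ᶠ k in atTop, ∃ x ∈ M (ybar + t k • v), ‖x - xbar‖ ≤ κ * ‖t k • v‖ := by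
    filter_upwards [hlim.eventually_lt_const hε] with k hk
    simpa using hM (ybar + t k • v) (by simpa using hk)
  obtain ⟨φ, hφ, hex⟩ := extraction_of_eventually_atTop hev
  choose x hxM hxle using hex
  obtain ⟨u, -, ψ, hψ, hu⟩ := (isCompact_closedBall (0 : X) (κ * ‖v‖)).tendsto_subseq
    (x := fun k => (t (φ k))⁻¹ • (x k - xbar)) (fun k => by
      have hk := ht (φ k)
      rw [mem_closedBall_zero_iff, norm_smul, norm_inv, Real.norm_eq_abs, abs_of_pos hk,
        inv_mul_le_iff₀ hk]
      refine (hxle k).trans (le_of_eq ?_)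
      rw [norm_smul, Real.norm_eq_abs, abs_of_pos hk]
      ring)
  refine ⟨u, hx, fun k => t (φ (ψ k)), fun k => pair v ((t (φ (ψ k)))⁻¹ • (x (ψ k) - xbar)),
    fun k => ht _, ht0.comp (hφ.comp hψ).tendsto_atTop, tendsto_pair tendsto_const_nhds hu,
    fun k => ?_⟩
  have := hxM (ψ k)
  simpa [svGraph, smul_inv_smul₀ (ht (φ (ψ k))).ne'] using this

/-- A regular normal y* to the domain lifts to the normal (y*, 0) at any graph point above; inner
semicompactness lets these points converge. -/
theorem limitingNormalCone_svDom_subset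
    (hcl : ∀ x, LocallyClosedAround (svGraph M) (pair ybar x))
    (hsc : InnerSemicompactAt M ybar (svDom M)) :
    limitingNormalCone (svDom M) ybar ⊆ ⋃ xbar ∈ M ybar, limitingCoderiv M ybar xbar 0 := by
  rintro ys ⟨-, y, q, hy, hq, hmem⟩
  obtain ⟨xbar, φ, x, hφ, hx, hxM⟩ := hsc y (fun k => (hmem k).1) hy
  have hlim := tendsto_pair (hy.comp hφ.tendsto_atTop) hx
  have hxbar : xbar ∈ M ybar := (hcl xbar).mem_of_tendsto hlim hxM
  rw [Set.mem_iUnion₂]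
  refine ⟨xbar, hxbar, ?_⟩
  change pair ys (-(0 : X)) ∈ limitingNormalCone (svGraph M) (pair ybar xbar)
  rw [neg_zero]
  exact ⟨hxbar, _, fun k => pair (q (φ k)) 0, hlim,
    tendsto_pair (hq.comp hφ.tendsto_atTop) tendsto_const_nhds,
    fun k => pair_zero_mem_regularNormalCone_svGraph (hmem (φ k)) (hxM k)⟩

variable [FiniteDimensional ℝ Y] [FiniteDimensional ℝ X]

/-- Preimages of points which converge more slowly than their images force inner calmness at a
nearby point of the limiting image. -/
theorem FOSCclm.exists_innerCalmAt (h : FOSCclm M ybar xbar) (hx : xbar ∈ M ybar)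
    (hcl : LocallyClosedAround (svGraph M) (pair ybar xbar)) :
    ∃ ε > 0, ∀ y x, x ∈ M y → 0 < ‖x - xbar‖ → ‖x - xbar‖ < ε → ‖y - ybar‖ ≤ ε * ‖x - xbar‖ →
      ∃ x' ∈ M ybar, InnerCalmAt M ybar x' := by
  obtain ⟨ε, hε, κ, hκ, hL⟩ := h.exists_lipschitzLike hx hcl
  -- With these constants, x' lies within ‖x - xbar‖ / 2 of x, hence x' ≠ xbar and ‖x' - xbar‖ < ε.
  -- The Lipschitz-like property then applies a second time, at (ybar, x').
  refine ⟨min (ε / 2) (1 / (2 * κ)), by positivity, fun y x hxy h0 hs hy => ?_⟩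
  have h1 : ‖y - ybar‖ ≤ ε / 2 * ‖x - xbar‖ := hy.trans (by gcongr; exact min_le_left _ _)
  have h2 : κ * ‖y - ybar‖ ≤ 1 / 2 * ‖x - xbar‖ := by
    calc κ * ‖y - ybar‖ ≤ κ * (1 / (2 * κ) * ‖x - xbar‖) := by
          gcongr; exact hy.trans (by gcongr; exact min_le_right _ _)
      _ = _ := by field_simp
  have h3 : ‖x - xbar‖ < ε / 2 := hs.trans_le (min_le_left _ _)
  obtain ⟨x', hx', hx'x⟩ := hL y x hxy h0 (by linarith)
    (h1.trans (by gcongr; linarith)) ybar (by simp; positivity)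
  rw [norm_sub_rev ybar] at hx'x
  have h4 : ‖x' - xbar‖ ≤ 1 / 2 * ‖x - xbar‖ + ‖x - xbar‖ := by
    rw [← sub_add_sub_cancel x' x xbar]; exact (norm_add_le _ _).trans (by linarith)
  have h5 : 1 / 2 * ‖x - xbar‖ ≤ ‖x' - xbar‖ := by
    have := norm_sub_le (x' - xbar) (x' - x)
    rw [show x' - xbar - (x' - x) = x - xbar by abel] at this
    linarith
  refine ⟨x', hx', ε * ‖x' - xbar‖, mul_pos hε (by linarith), κ, hκ, fun y' hy' => ?_⟩
  exact hL ybar x' hx' (by linarith) (by linarith) (by simp; positivity) y' hy'.le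

/-- Along a directionally convergent sequence in the domain, either preimages can be chosen which
converge directionally along a subsequence, or the mapping is inner calm at some point. -/
theorem exists_subseq_or_innerCalmAt
    (hcl : ∀ x, LocallyClosedAround (svGraph M) (pair ybar x))
    (hsc : InnerSemicompactAt M ybar (svDom M)) (h : ∀ xbar ∈ M ybar, FOSCclm M ybar xbar)
    {t : ℕ → ℝ} {w : ℕ → Y} {v : Y} (ht : ∀ k, 0 < t k) (ht0 : Tendsto t atTop (𝓝 0))
    (hw : Tendsto w atTop (𝓝 v)) (hmem : ∀ k, ybar + t k • w k ∈ svDom M) :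
    (∃ xbar ∈ M ybar, ∃ (φ : ℕ → ℕ) (u' : ℕ → X) (u : X), StrictMono φ ∧
      (∀ k, xbar + t (φ k) • u' k ∈ M (ybar + t (φ k) • w (φ k))) ∧ Tendsto u' atTop (𝓝 u)) ∨
    ∃ xbar ∈ M ybar, InnerCalmAt M ybar xbar := by
  have hylim : Tendsto (fun k => ybar + t k • w k) atTop (𝓝 ybar) := by
    simpa using tendsto_const_nhds.add (ht0.smul hw)
  obtain ⟨xbar, φ, x, hφ, hx, hxM⟩ := hsc _ hmem hylim
  have hxbar : xbar ∈ M ybar :=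
    (hcl xbar).mem_of_tendsto (tendsto_pair (hylim.comp hφ.tendsto_atTop) hx) hxM
  obtain ⟨ε, hε, hcalm⟩ := (h xbar hxbar).exists_innerCalmAt hxbar (hcl xbar)
  have hwb : ∀ᶠ k in atTop, ‖w (φ k)‖ < ‖v‖ + 1 :=
    (hw.comp hφ.tendsto_atTop).norm.eventually_lt_const (by linarith)
  have hxb : ∀ᶠ k in atTop, ‖x k - xbar‖ < ε :=
    (tendsto_iff_norm_sub_tendsto_zero.1 hx).eventually_lt_const hε
  -- Beyond this radius, ε‖x - xbar‖ > t(‖v‖ + 1), which eventually exceeds t‖w‖ = ‖y - ybar‖: the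
  -- cone condition holds.
  by_cases hfr : ∃ᶠ k in atTop,
      (t (φ k))⁻¹ • (x k - xbar) ∈ Metric.closedBall (0 : X) ((‖v‖ + 1) / ε)
  · left
    obtain ⟨u, -, ψ, hψ, hu⟩ :=
      tendsto_subseq_of_frequently_bounded Metric.isBounded_closedBall hfr
    refine ⟨xbar, hxbar, φ ∘ ψ, _, u, hφ.comp hψ, fun k => ?_, hu⟩
    simpa [smul_inv_smul₀ (ht (φ (ψ k))).ne'] using hxM (ψ k)
  · right
    obtain ⟨k, h1, h2, h3⟩ := ((not_frequently.1 hfr).and (hwb.and hxb)).exists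
    have hk := ht (φ k)
    rw [mem_closedBall_zero_iff, not_le, norm_smul, norm_inv, Real.norm_eq_abs, abs_of_pos hk,
      lt_inv_mul_iff₀ hk, ← mul_div_assoc, div_lt_iff₀ hε] at h1
    have h4 : 0 < t (φ k) * (‖v‖ + 1) := by positivity
    refine hcalm _ _ (hxM k) ?_ h3 ?_
    · by_contra! hle
      have : ‖x k - xbar‖ = 0 := hle.antisymm (norm_nonneg _)
      rw [this] at h1
      linarith
    · rw [add_sub_cancel_left, norm_smul, Real.norm_eq_abs, abs_of_pos hk]
      have : t (φ k) * ‖w (φ k)‖ ≤ t (φ k) * (‖v‖ + 1) := by gcongr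
      linarith

theorem tangentCone_svDom
    (hcl : ∀ x, LocallyClosedAround (svGraph M) (pair ybar x))
    (hsc : InnerSemicompactAt M ybar (svDom M)) (h : ∀ xbar ∈ M ybar, FOSCclm M ybar xbar) :
    tangentCone (svDom M) ybar = ⋃ xbar ∈ M ybar, svDom (graphicalDeriv M ybar xbar) := by
  refine Set.Subset.antisymm ?_ (Set.iUnion₂_subset fun x _ => svDom_graphicalDeriv_subset)
  rintro v ⟨-, t, w, ht, ht0, hw, hmem⟩
  rw [Set.mem_iUnion₂]
  rcases exists_subseq_or_innerCalmAt hcl hsc h ht ht0 hw hmem with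
    ⟨xbar, hx, φ, u', u, hφ, hu'M, hu'⟩ | ⟨xbar, hx, hcalm⟩
  · exact ⟨xbar, hx, u, hx, t ∘ φ, fun k => pair (w (φ k)) (u' k), fun k => ht _,
      ht0.comp hφ.tendsto_atTop, tendsto_pair (hw.comp hφ.tendsto_atTop) hu', hu'M⟩
  · exact ⟨xbar, hx, hcalm.nonempty_graphicalDeriv hx v⟩

/-- The polar of a union is the intersection of the polars, applied to the formula for the tangent
cone. -/
theorem regularNormalCone_svDom (hy : ybar ∈ svDom M)
    (hcl : ∀ x, LocallyClosedAround (svGraph M) (pair ybar x))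
    (hsc : InnerSemicompactAt M ybar (svDom M)) (h : ∀ xbar ∈ M ybar, FOSCclm M ybar xbar) :
    regularNormalCone (svDom M) ybar = ⋂ xbar ∈ M ybar, regularCoderiv M ybar xbar 0 := by
  ext ys
  rw [Set.mem_iInter₂]
  constructor
  · exact fun hys x hx => (mem_regularCoderiv_zero_iff hx).2
      fun v hv => hys.2 v (svDom_graphicalDeriv_subset hv)
  · refine fun hys => ⟨hy, fun v hv => ?_⟩
    rw [tangentCone_svDom hcl hsc h, Set.mem_iUnion₂] at hv
    obtain ⟨x, hx, hv⟩ := hv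
    exact (mem_regularCoderiv_zero_iff hx).1 (hys x hx) v hv

theorem dirLimitingNormalCone_svDom_subset
    (hcl : ∀ x, LocallyClosedAround (svGraph M) (pair ybar x))
    (hsc : InnerSemicompactAt M ybar (svDom M)) (h : ∀ xbar ∈ M ybar, FOSCclm M ybar xbar)
    (v : Y) :
    dirLimitingNormalCone (svDom M) ybar v ⊆ ⋃ xbar ∈ M ybar,
      ⋃ u ∈ graphicalDeriv M ybar xbar v, dirLimitingCoderiv M ybar xbar v u 0 := by
  rintro ys ⟨-, t, w, q, ht, ht0, hw, hq, hmem⟩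
  simp only [Set.mem_iUnion]
  rcases exists_subseq_or_innerCalmAt hcl hsc h ht ht0 hw (fun k => (hmem k).1) with
    ⟨xbar, hx, φ, u', u, hφ, hu'M, hu'⟩ | ⟨xbar, hx, hcalm⟩
  · have hlim := tendsto_pair (hw.comp hφ.tendsto_atTop) hu'
    refine ⟨xbar, hx, u, ⟨hx, t ∘ φ, _, fun k => ht _, ht0.comp hφ.tendsto_atTop, hlim, hu'M⟩, ?_⟩
    change pair ys (-(0 : X)) ∈ dirLimitingNormalCone (svGraph M) (pair ybar xbar) (pair v u)
    rw [neg_zero]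
    exact ⟨hx, t ∘ φ, _, fun k => pair (q (φ k)) 0, fun k => ht _, ht0.comp hφ.tendsto_atTop,
      hlim, tendsto_pair (hq.comp hφ.tendsto_atTop) tendsto_const_nhds,
      fun k => pair_zero_mem_regularNormalCone_svGraph (hmem (φ k)) (hu'M k)⟩
  -- Here ybar is interior to the domain, so ys = 0, and zero is a directional normal in any tangent
  -- direction (v, u).
  · obtain ⟨u, hu⟩ := hcalm.nonempty_graphicalDeriv hx v
    refine ⟨xbar, hx, u, hu, ?_⟩
    have hylim : Tendsto (fun k => ybar + t k • w k) atTop (𝓝 ybar) := by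
      simpa using tendsto_const_nhds.add (ht0.smul hw)
    have hq0 : ∀ᶠ k in atTop, q k = 0 := by
      filter_upwards [hylim.eventually (eventually_mem_nhds_iff.2 hcalm.mem_nhds)] with k hk
      exact eq_zero_of_mem_regularNormalCone_of_mem_nhds hk (hmem k)
    have : ys = 0 :=
      tendsto_nhds_unique hq (tendsto_const_nhds.congr' (hq0.mono fun k hk => hk.symm))
    subst this
    change pair (0 : Y) (-(0 : X)) ∈
      dirLimitingNormalCone (svGraph M) (pair ybar xbar) (pair v u)
    rw [neg_zero]
    exact zero_mem_dirLimitingNormalCone hu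

end Domain

end VarAn

theorem mainTheorem5 {m n : ℕ}
    (M : EuclideanSpace ℝ (Fin m) → Set (EuclideanSpace ℝ (Fin n)))
    (ybar : EuclideanSpace ℝ (Fin m)) (hy : ybar ∈ VarAn.svDom M) :
    ((∀ x, VarAn.LocallyClosedAround (VarAn.svGraph M) (VarAn.pair ybar x)) →
      VarAn.InnerSemicompactAt M ybar (VarAn.svDom M) →
      (∀ xbar ∈ M ybar, VarAn.FOSCclm M ybar xbar) →
        VarAn.tangentCone (VarAn.svDom M) ybar =
            ⋃ xbar ∈ M ybar, VarAn.svDom (VarAn.graphicalDeriv M ybar xbar) ∧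
        VarAn.regularNormalCone (VarAn.svDom M) ybar =
            ⋂ xbar ∈ M ybar, VarAn.regularCoderiv M ybar xbar 0 ∧
        VarAn.limitingNormalCone (VarAn.svDom M) ybar ⊆
            ⋃ xbar ∈ M ybar, VarAn.limitingCoderiv M ybar xbar 0 ∧
        ∀ v, VarAn.dirLimitingNormalCone (VarAn.svDom M) ybar v ⊆
            ⋃ xbar ∈ M ybar, ⋃ u ∈ VarAn.graphicalDeriv M ybar xbar v,
              VarAn.dirLimitingCoderiv M ybar xbar v u 0) ∧
    (∀ xbar ∈ M ybar,
      VarAn.LocallyClosedAround (VarAn.svGraph M) (VarAn.pair ybar xbar) →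
      VarAn.FOSCclm M ybar xbar →
        VarAn.tangentCone (M ybar) xbar = VarAn.graphicalDeriv M ybar xbar 0 ∧
        -VarAn.svDom (VarAn.regularCoderiv M ybar xbar) ⊆
            VarAn.regularNormalCone (M ybar) xbar ∧
        VarAn.limitingNormalCone (M ybar) xbar ⊆
            -VarAn.svDom (VarAn.limitingCoderiv M ybar xbar) ∧
        ∀ u, VarAn.dirLimitingNormalCone (M ybar) xbar u ⊆
            -VarAn.svDom (VarAn.dirLimitingCoderiv M ybar xbar 0 u)) :=
  ⟨fun hcl hsc h => ⟨VarAn.tangentCone_svDom hcl hsc h, VarAn.regularNormalCone_svDom hy hcl hsc h,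
    VarAn.limitingNormalCone_svDom_subset hcl hsc,
    VarAn.dirLimitingNormalCone_svDom_subset hcl hsc h⟩,
   fun _ hx hcl h => ⟨h.tangentCone_image hx hcl, VarAn.neg_svDom_regularCoderiv_subset hx,
    h.limitingNormalCone_image_subset hcl, h.dirLimitingNormalCone_image_subset hcl⟩⟩
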